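/- Define integer sequences by $u_0=0$, $u_1=1$, $u_{n+1}=5u_n-5u_{n-1}$ and $v_0=2$, $v_1=5$, $v_{n+1}=5v_n-5v_{n-1}$ for $n\ge 1$ (the Lucas sequences $u_n=u_n(5,5)$ and $v_n=v_n(5,5)$). Let $p$ be a prime with $p\neq 2,5$, and let $\left(\frac p5\right)$ denote the Jacobi symbol. For rational numbers $x,y$ write $x\equiv y \pmod{p^2}$ if $p^2$ divides the numerator of $x-y$ in lowest terms. Then $$\sum_{k=0}^{p-1}\frac{u_k}{5^k}\binom{2k}k\equiv(-1)^{\lfloor p/5\rfloor}\left(\left(\frac p5\right)-1\right)\pmod{p^2},$$ $$\sum_{k=0}^{p-1}\frac{u_{k+1}}{5^k}\binom{2k}k\equiv(-1)^{\lfloor p/5\rfloor}\left(2\left(\frac p5\right)-1\right)\pmod{p^2},$$ $$\sum_{k=0}^{(p-1)/2}\frac{u_k}{16^k}\binom{2k}k\equiv\frac{\left(\frac p5\right)-1}2\pmod{p^2},$$ $$\sum_{k=0}^{(p-1)/2}\frac{v_k}{16^k}\binom{2k}k\equiv\frac{5\left(\frac p5\right)-1}2\pmod{p^2}.$$ -/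

import Mathlib

/-- The Lucas sequence `u_n(A, B)`: `u_0 = 0`, `u_1 = 1`, `u_{n+2} = A u_{n+1} - B u_n`. -/
def lucasU (A B : ℤ) : ℕ → ℤ
  | 0 => 0
  | 1 => 1
  | n + 2 => A * lucasU A B (n + 1) - B * lucasU A B n

/-- The companion Lucas sequence `v_n(A, B)`: `v_0 = 2`, `v_1 = A`,
`v_{n+2} = A v_{n+1} - B v_n`. -/
def lucasV (A B : ℤ) : ℕ → ℤ
  | 0 => 2
  | 1 => A
  | n + 2 => A * lucasV A B (n + 1) - B * lucasV A B n

/-- Congruence of rational numbers modulo `m`: the difference, in lowest terms, has numerator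
divisible by `m` (so that its denominator is automatically coprime to `m`). For `m = p ^ 2` this
says that the difference lies in `p ^ 2 ℤ_(p)`. -/
def RatModEq (m : ℕ) (x y : ℚ) : Prop :=
  (m : ℤ) ∣ (x - y).num

/-! Let ω² = 5ω − 5. The ω-coordinate of ω^k is u_k and its constant coordinate is u_{k+1} − 5u_k,
so each pair of sums becomes one sum of ω^k binom(2k,k), weighted by 5^{-k} or 16^{-k}, in ℤ[ω].
Write U for `vietaU` and p = 2j + 1. For base 5, the conjugate m = 5 − ω satisfies ωm = 5.
`sum_centralBinom_mul_pow` turns the sum into one of binom(2p,k) U_{p−k}(m−2), and binom(2p,k) ≡ 2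
binom(p,k) mod p² leaves a closed form in m^j and U. A congruence for m^j mod p then suffices, as
its error enters squared. For base 16, binom(2k,k) ≡ (−16)^k binom(j+k,2k) mod p² gives U_{j+1}(2−ω)
− U_j(2−ω) by `sum_choose_mul_neg_pow`. The arguments 3 − ω and 2 − ω are golden-ratio-like, so U
has period 10 or 5 and finitely many residues of j remain. -/

/-- The solution of `f (n + 2) = w * f (n + 1) - f n` with `f 0 = 0` and `f 1 = 1`. -/
def vietaU {R : Type*} [CommRing R] (w : R) : ℕ → R
  | 0 => 0
  | 1 => 1
  | n + 2 => w * vietaU w (n + 1) - vietaU w n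

/-! ### Vieta sequences: periodicity and binomial sums -/

section Vieta

variable {R : Type*} [CommRing R]

theorem vietaU_zero (w : R) : vietaU w 0 = 0 := rfl

theorem vietaU_one (w : R) : vietaU w 1 = 1 := rfl

theorem vietaU_add_two (w : R) (n : ℕ) :
    vietaU w (n + 2) = w * vietaU w (n + 1) - vietaU w n := rfl

/-- The first identity factors U_p for odd p; the second only closes the induction. -/
theorem vietaU_sq_sub_sq (w : R) (n : ℕ) :
    vietaU w (n + 1) ^ 2 - vietaU w n ^ 2 = vietaU w (2 * n + 1) ∧
      vietaU w (n + 1) * (vietaU w (n + 2) - vietaU w n) = vietaU w (2 * n + 2) := by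
  induction n with
  | zero => simp [vietaU]
  | succ n ih =>
    have h1 : vietaU w (2 * (n + 1) + 1) = w * vietaU w (2 * n + 2) - vietaU w (2 * n + 1) := rfl
    have h2 : vietaU w (2 * (n + 1) + 2)
        = w * vietaU w (2 * (n + 1) + 1) - vietaU w (2 * n + 2) := rfl
    rw [h2, h1, ← ih.1, ← ih.2, vietaU_add_two w (n + 1), vietaU_add_two w n]
    constructor <;> ring

/-- U_5 = (w² − w − 1)(w² + w − 1), so either golden-ratio equation kills U_5. -/
theorem vietaU_add_five_of_pos (w : R) (hw : w ^ 2 = w + 1) (n : ℕ) :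
    vietaU w (n + 5) = -vietaU w n := by
  simp only [vietaU_add_two]
  linear_combination
    (vietaU w (n + 1) * (w ^ 2 + w - 1) - vietaU w n * (w + 1)) * hw

theorem vietaU_add_five_of_neg (w : R) (hw : w ^ 2 = 1 - w) (n : ℕ) :
    vietaU w (n + 5) = vietaU w n := by
  simp only [vietaU_add_two]
  linear_combination
    (vietaU w (n + 1) * (w ^ 2 - w - 1) - vietaU w n * (w - 1)) * hw

theorem vietaU_of_mod_ten (w : R) (hw : w ^ 2 = w + 1) (n : ℕ) :
    vietaU w n = vietaU w (n % 10) := by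
  have key (i k : ℕ) : vietaU w (i + 10 * k) = vietaU w i := by
    induction k with
    | zero => rfl
    | succ k ih =>
      rw [show i + 10 * (k + 1) = (i + 10 * k + 5) + 5 by ring, vietaU_add_five_of_pos w hw,
        vietaU_add_five_of_pos w hw, ih, neg_neg]
  rw [← key (n % 10) (n / 10), Nat.mod_add_div]

theorem vietaU_of_mod_five (w : R) (hw : w ^ 2 = 1 - w) (n : ℕ) :
    vietaU w n = vietaU w (n % 5) := by
  have key (i k : ℕ) : vietaU w (i + 5 * k) = vietaU w i := by
    induction k with
    | zero => rfl
    | succ k ih =>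
      rw [show i + 5 * (k + 1) = (i + 5 * k) + 5 by ring, vietaU_add_five_of_neg w hw, ih]
  rw [← key (n % 5) (n / 5), Nat.mod_add_div]

theorem sum_choose_succ_mul (f : ℕ → R) (n : ℕ) :
    ∑ k ∈ Finset.range (n + 2), ((n + 1).choose k : R) * f k =
      ∑ k ∈ Finset.range (n + 1), (n.choose k : R) * (f k + f (k + 1)) := by
  rw [Finset.sum_range_succ']
  simp only [Nat.choose_succ_succ, Nat.cast_add, add_mul, mul_add, Finset.sum_add_distrib]
  have h := Finset.sum_range_succ' (fun k => (n.choose k : R) * f k) (n + 1)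
  rw [Finset.sum_range_succ] at h
  simp only [Nat.choose_succ_self, Nat.cast_zero, zero_mul, add_zero] at h
  rw [h]
  simp
  ring

/-- With E the shift, `hf` says (1 + E)² = mE, hence (1 + E)^{2j} = m^j E^j. -/
theorem sum_choose_two_mul (m : R) (f : ℕ → R)
    (hf : ∀ i, f i + 2 * f (i + 1) + f (i + 2) = m * f (i + 1)) (j i : ℕ) :
    ∑ k ∈ Finset.range (2 * j + 1), ((2 * j).choose k : R) * f (k + i) = m ^ j * f (j + i) := by
  induction j generalizing i with
  | zero => simp
  | succ j ih =>
    have h1 := sum_choose_succ_mul (fun k => f (k + i)) (2 * j + 1)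
    have h2 := sum_choose_succ_mul (fun k => f (k + i) + f (k + 1 + i)) (2 * j)
    rw [show 2 * (j + 1) = 2 * j + 1 + 1 by ring, h1, h2]
    have h3 : ∀ k, f (k + i) + f (k + 1 + i) + (f (k + 1 + i) + f (k + 1 + 1 + i))
        = m * f (k + (i + 1)) := fun k => by
      have := hf (k + i)
      rw [show k + 1 + i = k + i + 1 by ring, show k + 1 + 1 + i = k + i + 2 by ring,
        show k + (i + 1) = k + i + 1 by ring]
      linear_combination this
    simp only [h3]
    have h4 := ih (i + 1)
    rw [show j + 1 + i = j + (i + 1) by ring, pow_succ, mul_right_comm, ← h4, Finset.sum_mul]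
    exact Finset.sum_congr rfl fun k _ => by ring

theorem vietaU_three_term (m : R) (i : ℕ) :
    vietaU (m - 2) i + 2 * vietaU (m - 2) (i + 1) + vietaU (m - 2) (i + 2)
      = m * vietaU (m - 2) (i + 1) := by
  rw [vietaU_add_two]; ring

theorem sum_choose_mul_vietaU (m : R) (j : ℕ) :
    ∑ k ∈ Finset.range (2 * j + 2), ((2 * j + 1).choose k : R) * vietaU (m - 2) k
      = m ^ j * (vietaU (m - 2) (j + 1) + vietaU (m - 2) j) := by
  rw [sum_choose_succ_mul]
  have h0 := sum_choose_two_mul m _ (vietaU_three_term m) j 0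
  have h1 := sum_choose_two_mul m _ (vietaU_three_term m) j 1
  simp only [add_zero] at h0
  simp only [mul_add, Finset.sum_add_distrib, h0, h1]
  ring

/-- Pascal's rule applied twice turns binom(2n+2,k) into the weights 1, 2, 1, and the three-term
relation turns these into multiplication by m. The boundary term k = n supplies the new binom(2n,n).
-/
theorem sum_centralBinom_mul_pow (m : R) (n : ℕ) :
    ∑ k ∈ Finset.range n, ((2 * k).choose k : R) * m ^ (n - 1 - k)
      = ∑ k ∈ Finset.range n, ((2 * n).choose k : R) * vietaU (m - 2) (n - k) := by
  induction n with
  | zero => simp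
  | succ n ih =>
    have hL : ∑ k ∈ Finset.range (n + 1), ((2 * k).choose k : R) * m ^ (n + 1 - 1 - k)
        = m * ∑ k ∈ Finset.range n, ((2 * k).choose k : R) * m ^ (n - 1 - k)
          + (2 * n).choose n := by
      rw [Finset.sum_range_succ, Finset.mul_sum]
      congr 1
      · refine Finset.sum_congr rfl fun k hk => ?_
        rw [Finset.mem_range] at hk
        rw [show n + 1 - 1 - k = n - 1 - k + 1 by omega, pow_succ]
        ring
      · simp
    have hstep (N : ℕ) (g : ℕ → R) (l : ℕ) :
        ∑ k ∈ Finset.range (l + 1), ((N + 1).choose k : R) * g k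
          = ∑ k ∈ Finset.range (l + 1), (N.choose k : R) * g k
            + ∑ k ∈ Finset.range l, (N.choose k : R) * g (k + 1) := by
      rw [Finset.sum_range_succ', Finset.sum_range_succ' (fun k => (N.choose k : R) * g k)]
      simp only [Nat.choose_succ_succ, Nat.cast_add, add_mul, Finset.sum_add_distrib]
      simp
      ring
    rw [hL, ih, show 2 * (n + 1) = 2 * n + 1 + 1 by ring, hstep, hstep]
    cases n with
    | zero => simp [vietaU]
    | succ l =>
      rw [hstep (2 * (l + 1)) (fun k => vietaU (m - 2) (l + 1 + 1 - (k + 1)))]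
      rw [Finset.sum_range_succ _ (l + 1)]
      have e1 : ∑ k ∈ Finset.range l, ((2 * (l + 1)).choose k : R)
            * vietaU (m - 2) (l + 1 + 1 - (k + 1 + 1))
          = ∑ k ∈ Finset.range (l + 1), ((2 * (l + 1)).choose k : R)
            * vietaU (m - 2) (l + 1 + 1 - (k + 1 + 1)) := by
        rw [Finset.sum_range_succ]; simp [vietaU]
      have e2 : ∑ k ∈ Finset.range (l + 1), m * (((2 * (l + 1)).choose k : R)
            * vietaU (m - 2) (l + 1 - k))
          = ∑ k ∈ Finset.range (l + 1), (((2 * (l + 1)).choose k : R)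
              * vietaU (m - 2) (l + 1 + 1 - k)
            + 2 * (((2 * (l + 1)).choose k : R) * vietaU (m - 2) (l + 1 + 1 - (k + 1)))
            + ((2 * (l + 1)).choose k : R) * vietaU (m - 2) (l + 1 + 1 - (k + 1 + 1))) := by
        refine Finset.sum_congr rfl fun k hk => ?_
        rw [Finset.mem_range] at hk
        obtain ⟨i, rfl⟩ : ∃ i, l = k + i := ⟨l - k, by omega⟩
        rw [show k + i + 1 - k = i + 1 by omega, show k + i + 1 + 1 - k = i + 2 by omega,
          show k + i + 1 + 1 - (k + 1) = i + 1 by omega,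
          show k + i + 1 + 1 - (k + 1 + 1) = i by omega]
        linear_combination (-((2 * (k + i + 1)).choose k : R)) * vietaU_three_term m i
      rw [e1, Finset.mul_sum, e2]
      simp only [Finset.sum_add_distrib, ← Finset.mul_sum]
      rw [show l + 1 + 1 - (l + 1) = 1 by omega, vietaU_one]
      ring

theorem sum_choose_mul_neg_pow (x : R) (j : ℕ) :
    ∑ k ∈ Finset.range (j + 1), ((j + k).choose (2 * k) : R) * (-x) ^ k
      = vietaU (2 - x) (j + 1) - vietaU (2 - x) j := by
  have hB (j : ℕ) : ∑ k ∈ Finset.range (j + 2), ((j + 1 + k).choose (2 * k) : R) * (-x) ^ k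
      = ∑ k ∈ Finset.range (j + 1), ((j + k).choose (2 * k) : R) * (-x) ^ k
        - x * ∑ k ∈ Finset.range (j + 1), ((j + 1 + k).choose (2 * k + 1) : R) * (-x) ^ k := by
    have h : ∑ k ∈ Finset.range (j + 1), ((j + k).choose (2 * k) : R) * (-x) ^ k
        = ∑ k ∈ Finset.range (j + 2), ((j + k).choose (2 * k) : R) * (-x) ^ k := by
      rw [Finset.sum_range_succ _ (j + 1), Nat.choose_eq_zero_of_lt (by omega)]
      simp
    rw [h, Finset.sum_range_succ', Finset.sum_range_succ' _ (j + 1), Finset.mul_sum]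
    have : ∀ k, ((j + 1 + (k + 1)).choose (2 * (k + 1)) : R) * (-x) ^ (k + 1)
        = ((j + (k + 1)).choose (2 * (k + 1)) : R) * (-x) ^ (k + 1)
          - x * (((j + 1 + k).choose (2 * k + 1) : R) * (-x) ^ k) := fun k => by
      rw [show j + 1 + (k + 1) = j + 1 + k + 1 by ring, show 2 * (k + 1) = 2 * k + 1 + 1 by ring,
        Nat.choose_succ_succ, show j + (k + 1) = j + 1 + k by ring]
      push_cast
      ring
    simp only [this, Finset.sum_sub_distrib]
    simp
    ring
  have hA (j : ℕ) : ∑ k ∈ Finset.range (j + 2), ((j + 2 + k).choose (2 * k + 1) : R) * (-x) ^ k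
      = ∑ k ∈ Finset.range (j + 1), ((j + 1 + k).choose (2 * k + 1) : R) * (-x) ^ k
        + ∑ k ∈ Finset.range (j + 2), ((j + 1 + k).choose (2 * k) : R) * (-x) ^ k := by
    have h : ∑ k ∈ Finset.range (j + 1), ((j + 1 + k).choose (2 * k + 1) : R) * (-x) ^ k
        = ∑ k ∈ Finset.range (j + 2), ((j + 1 + k).choose (2 * k + 1) : R) * (-x) ^ k := by
      rw [Finset.sum_range_succ _ (j + 1), Nat.choose_eq_zero_of_lt (by omega)]
      simp
    rw [h, ← Finset.sum_add_distrib]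
    refine Finset.sum_congr rfl fun k _ => ?_
    rw [show j + 2 + k = j + 1 + k + 1 by ring, Nat.choose_succ_succ]
    push_cast
    ring
  -- The odd-index companion sum is needed because Pascal's rule couples the two.
  suffices H : ∑ k ∈ Finset.range (j + 1), ((j + k).choose (2 * k) : R) * (-x) ^ k
        = vietaU (2 - x) (j + 1) - vietaU (2 - x) j ∧
      ∑ k ∈ Finset.range (j + 1), ((j + 1 + k).choose (2 * k + 1) : R) * (-x) ^ k
        = vietaU (2 - x) (j + 1) from H.1
  induction j with
  | zero => simp [vietaU]
  | succ j ih =>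
    rw [hA, hB, ih.1, ih.2, vietaU_add_two]
    constructor <;> ring

end Vieta

/-! ### Binomial coefficients modulo p² -/

/-- In Vandermonde's sum every inner term is a product of two multiples of p. -/
theorem sq_dvd_choose_two_mul_sub {p k : ℕ} (hp : p.Prime) (hk0 : k ≠ 0) (hkp : k < p) :
    ((p ^ 2 : ℕ) : ℤ) ∣ ((2 * p).choose k : ℤ) - 2 * p.choose k := by
  obtain ⟨k, rfl⟩ := Nat.exists_eq_succ_of_ne_zero hk0
  rw [two_mul, Nat.add_choose_eq, Finset.Nat.sum_antidiagonal_eq_sum_range_succ_mk,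
    Finset.sum_range_succ, Finset.sum_range_succ']
  simp only [Nat.succ_eq_add_one, Nat.sub_zero, Nat.sub_self, Nat.choose_zero_right, one_mul,
    mul_one]
  push_cast
  rw [show ∀ a b : ℤ, a + b + b - 2 * b = a from fun a b => by ring]
  refine Finset.dvd_sum fun i hi => ?_
  rw [Finset.mem_range] at hi
  rw [sq]
  exact mul_dvd_mul (Int.natCast_dvd_natCast.2 (hp.dvd_choose_self (by omega) (by omega)))
    (Int.natCast_dvd_natCast.2 (hp.dvd_choose_self (by omega) (by omega)))

/-- Ratios of consecutive terms agree mod p²: −16(j+k+1)(j−k) = 4(2k+1)² − 4p². Since 2k < p, the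
factor (2k)! can be cancelled. -/
theorem sq_dvd_centralBinom_sub {p j k : ℕ} (hp : p.Prime) (hj : p = 2 * j + 1) (hk : k ≤ j) :
    ((p ^ 2 : ℕ) : ℤ) ∣ ((2 * k).choose k : ℤ) - (-16) ^ k * (j + k).choose (2 * k) := by
  have hcop : IsCoprime ((p ^ 2 : ℕ) : ℤ) ((2 * k).factorial : ℤ) := by
    rw [Nat.isCoprime_iff_coprime]
    exact Nat.Coprime.pow_left 2 ((Nat.coprime_factorial_iff hp.one_lt.ne').2 (by
      rw [hp.minFac_eq]; omega))
  refine hcop.dvd_of_dvd_mul_left ?_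
  clear hcop
  induction k with
  | zero => simp
  | succ k ih =>
    have h1 : ((2 * (k + 1)).factorial : ℤ) * (2 * (k + 1)).choose (k + 1)
        = 4 * (2 * k + 1) ^ 2 * ((2 * k).factorial * (2 * k).choose k) := by
      have h := Nat.succ_mul_centralBinom_succ k
      simp only [Nat.centralBinom] at h
      rw [show 2 * (k + 1) = 2 * k + 1 + 1 by ring] at h ⊢
      rw [Nat.factorial_succ, Nat.factorial_succ]
      zify at h
      push_cast
      linear_combination (2 * (2 * k + 1) * (2 * k).factorial : ℤ) * h
    have h2 : ((2 * (k + 1)).factorial : ℤ) * (j + (k + 1)).choose (2 * (k + 1))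
        = (j + k + 1) * (j - k) * ((2 * k).factorial * (j + k).choose (2 * k)) := by
      have e1 := Nat.descFactorial_eq_factorial_mul_choose (j + (k + 1)) (2 * (k + 1))
      have e2 := Nat.descFactorial_eq_factorial_mul_choose (j + k) (2 * k)
      rw [show j + (k + 1) = j + k + 1 by ring, show 2 * (k + 1) = 2 * k + 1 + 1 by ring] at e1 ⊢
      rw [Nat.succ_descFactorial_succ, Nat.descFactorial_succ, e2] at e1
      zify at e1
      rw [← e1, Nat.cast_sub (by omega)]
      push_cast
      ring
    obtain ⟨c, hc⟩ := ih (by omega)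
    have hp' : (p : ℤ) = 2 * j + 1 := by exact_mod_cast hj
    refine ⟨4 * (2 * k + 1) ^ 2 * c
      + 4 * (-16) ^ k * ((2 * k).factorial * (j + k).choose (2 * k)), ?_⟩
    rw [mul_sub, mul_left_comm _ ((-16 : ℤ) ^ (k + 1)), h1, h2]
    push_cast at hc ⊢
    rw [hp'] at hc ⊢
    linear_combination (4 * (2 * k + 1) ^ 2 : ℤ) * hc

/-! ### The two sums modulo p² over any commutative ring -/

section CommRing

variable {R : Type*} [CommRing R]

theorem sq_dvd_sum_centralBinom_mul_pow_sub (m : R) {p j : ℕ} (hp : p.Prime)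
    (hj : p = 2 * j + 1) :
    ((p ^ 2 : ℕ) : R) ∣ ∑ k ∈ Finset.range p, ((2 * k).choose k : R) * m ^ (p - 1 - k)
      - (2 * (m ^ j * (vietaU (m - 2) (j + 1) + vietaU (m - 2) j)) - vietaU (m - 2) p) := by
  have h := sum_choose_mul_vietaU m j
  rw [← Finset.sum_flip, Finset.sum_range_succ, Nat.sub_self, vietaU_zero, mul_zero, add_zero,
    ← hj] at h
  have h' : ∑ k ∈ Finset.range p, (p.choose k : R) * vietaU (m - 2) (p - k)
      = m ^ j * (vietaU (m - 2) (j + 1) + vietaU (m - 2) j) := by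
    rw [← h]
    refine Finset.sum_congr rfl fun k hk => ?_
    rw [Nat.choose_symm (Finset.mem_range.1 hk).le]
  rw [sum_centralBinom_mul_pow, ← h']
  have hz : ∑ k ∈ Finset.range p, ((2 * p).choose k : R) * vietaU (m - 2) (p - k)
      - (2 * ∑ k ∈ Finset.range p, (p.choose k : R) * vietaU (m - 2) (p - k)
        - vietaU (m - 2) p)
      = ∑ k ∈ Finset.range (2 * j), ((((2 * p).choose (k + 1) : ℤ) - 2 * p.choose (k + 1) : ℤ) : R)
        * vietaU (m - 2) (p - (k + 1)) := by
    have e (f : ℕ → R) : ∑ k ∈ Finset.range p, f k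
        = ∑ k ∈ Finset.range (2 * j), f (k + 1) + f 0 := by
      rw [hj, Finset.sum_range_succ']
    rw [e, e]
    push_cast
    simp only [sub_mul, Finset.sum_sub_distrib, mul_assoc, ← Finset.mul_sum, Nat.sub_zero,
      Nat.choose_zero_right, Nat.cast_one]
    ring
  rw [hz]
  refine Finset.dvd_sum fun k hk => Dvd.dvd.mul_right ?_ _
  rw [Finset.mem_range] at hk
  have := map_dvd (Int.castRingHom R) (sq_dvd_choose_two_mul_sub hp k.succ_ne_zero
    (by omega : k + 1 < p))
  simpa using this

theorem dvd_pow_mul_sub_vietaU (m : R) {p j : ℕ} (hp : p.Prime) (hj : p = 2 * j + 1) :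
    (p : R) ∣ m ^ j * (vietaU (m - 2) (j + 1) + vietaU (m - 2) j) - vietaU (m - 2) p := by
  rw [← sum_choose_mul_vietaU, ← hj, show 2 * j + 2 = p + 1 by omega, Finset.sum_range_succ,
    Nat.choose_self, Nat.cast_one, one_mul, add_sub_cancel_right]
  refine Finset.dvd_sum fun k hk => ?_
  rw [Finset.mem_range] at hk
  rcases eq_or_ne k 0 with rfl | h0
  · simp [vietaU]
  · exact ((Nat.cast_dvd_cast (hp.dvd_choose_self h0 hk) : (p : R) ∣ _)).mul_right _

/-- With r, q the sum and difference of U_{j+1}, U_j, one has U_p = rq. As r is a unit, m^j ≡ q mod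
p, so (m^j − q)² ≡ 0 mod p² and 2m^j r − rq = c(2m^j q − q²) ≡ c m^{p−1}. -/
theorem sq_dvd_sum_centralBinom_mul_pow_mul_five_pow_sub {a m : R} (ham : a * m = 5)
    {p j : ℕ} (hp : p.Prime) (hj : p = 2 * j + 1) {c s : R}
    (hc : vietaU (m - 2) (j + 1) + vietaU (m - 2) j
      = c * (vietaU (m - 2) (j + 1) - vietaU (m - 2) j))
    (hs : s * (vietaU (m - 2) (j + 1) + vietaU (m - 2) j) = 1) :
    ((p ^ 2 : ℕ) : R) ∣ ∑ k ∈ Finset.range p, ((2 * k).choose k : R) * (a ^ k * 5 ^ (p - 1 - k))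
      - 5 ^ (p - 1) * c := by
  have hS : ∑ k ∈ Finset.range p, ((2 * k).choose k : R) * (a ^ k * 5 ^ (p - 1 - k))
      = a ^ (p - 1) * ∑ k ∈ Finset.range p, ((2 * k).choose k : R) * m ^ (p - 1 - k) := by
    rw [Finset.mul_sum]
    refine Finset.sum_congr rfl fun k hk => ?_
    rw [Finset.mem_range] at hk
    obtain ⟨i, hi⟩ : ∃ i, p - 1 = k + i := ⟨p - 1 - k, by omega⟩
    rw [hi, Nat.add_sub_cancel_left, ← ham, mul_pow, pow_add]
    ring
  rw [hS]
  obtain ⟨x, hx⟩ := sq_dvd_sum_centralBinom_mul_pow_sub m hp hj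
  obtain ⟨y, hy⟩ := dvd_pow_mul_sub_vietaU m hp hj
  have hU := (vietaU_sq_sub_sq (m - 2) j).1
  rw [← hj] at hU
  rw [← hU] at hx hy
  have h5 : (5 : R) ^ (p - 1) = a ^ (p - 1) * (m ^ j) ^ 2 := by
    rw [← ham, mul_pow, ← pow_mul, show j * 2 = p - 1 by omega]
  rw [h5]
  set r := vietaU (m - 2) (j + 1) + vietaU (m - 2) j with hr
  set q := vietaU (m - 2) (j + 1) - vietaU (m - 2) j with hq
  have hrq : vietaU (m - 2) (j + 1) ^ 2 - vietaU (m - 2) j ^ 2 = r * q := by rw [hr, hq]; ring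
  rw [hrq] at hx hy
  have hy' : m ^ j - q = p * (s * y) := by linear_combination s * hy - (m ^ j - q) * hs
  refine ⟨a ^ (p - 1) * x - a ^ (p - 1) * c * (s * y) ^ 2, ?_⟩
  push_cast at hx ⊢
  linear_combination a ^ (p - 1) * hx + a ^ (p - 1) * (2 * m ^ j - q) * hc
    - a ^ (p - 1) * c * (m ^ j - q + p * (s * y)) * hy'

theorem sq_dvd_sum_centralBinom_mul_pow_mul_sixteen_pow_sub (a : R) {p j : ℕ} (hp : p.Prime)
    (hj : p = 2 * j + 1) :
    ((p ^ 2 : ℕ) : R) ∣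
      ∑ k ∈ Finset.range (j + 1), ((2 * k).choose k : R) * (a ^ k * 16 ^ (j - k))
        - 16 ^ j * (vietaU (2 - a) (j + 1) - vietaU (2 - a) j) := by
  rw [← sum_choose_mul_neg_pow, Finset.mul_sum, ← Finset.sum_sub_distrib]
  refine Finset.dvd_sum fun k hk => ?_
  rw [Finset.mem_range] at hk
  obtain ⟨i, rfl⟩ : ∃ i, j = k + i := ⟨j - k, by omega⟩
  obtain ⟨c, hc⟩ := map_dvd (Int.castRingHom R)
    (sq_dvd_centralBinom_sub (k := k) hp hj (by omega))
  simp only [map_sub, map_mul, map_pow, map_neg, eq_intCast, Int.cast_natCast,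
    Int.cast_ofNat] at hc
  refine ⟨c * (a ^ k * 16 ^ i), ?_⟩
  have h1 : (-a) ^ k = (-1) ^ k * a ^ k := by rw [neg_pow]
  have h2 : (-16 : R) ^ k = (-1) ^ k * 16 ^ k := by rw [neg_pow]
  rw [h2] at hc
  rw [h1, Nat.add_sub_cancel_left, pow_add]
  linear_combination (a ^ k * 16 ^ i) * hc

end CommRing

/-! ### Specialization to ℤ[ω] and residue cases -/

section Quadratic

open QuadraticAlgebra

theorem omega_pow_eq_lucasU (k : ℕ) :
    (⟨0, 1⟩ : QuadraticAlgebra ℤ (-5) 5) ^ k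
      = ⟨lucasU 5 5 (k + 1) - 5 * lucasU 5 5 k, lucasU 5 5 k⟩ := by
  induction k with
  | zero => ext <;> simp [lucasU]
  | succ k ih =>
    rw [pow_succ, ih]
    ext <;> simp [lucasU]

theorem lucasV_eq (k : ℕ) :
    lucasV 5 5 k = 2 * lucasU 5 5 (k + 1) - 5 * lucasU 5 5 k ∧
      lucasV 5 5 (k + 1) = 2 * lucasU 5 5 (k + 2) - 5 * lucasU 5 5 (k + 1) := by
  induction k with
  | zero => simp [lucasU, lucasV]
  | succ k ih =>
    refine ⟨ih.2, ?_⟩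
    rw [lucasV, ih.1, ih.2]
    simp only [lucasU]
    ring

theorem sum_mul_omega_pow_mul_pow (c d : ℕ → ℕ) (b : ℕ) (n : ℕ) :
    ∑ k ∈ Finset.range n,
        (c k : QuadraticAlgebra ℤ (-5) 5) * ((⟨0, 1⟩ : QuadraticAlgebra ℤ (-5) 5) ^ k
          * (b : QuadraticAlgebra ℤ (-5) 5) ^ d k)
      = ⟨∑ k ∈ Finset.range n, (lucasU 5 5 (k + 1) - 5 * lucasU 5 5 k) * b ^ d k * c k,
          ∑ k ∈ Finset.range n, lucasU 5 5 k * b ^ d k * c k⟩ := by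
  induction n with
  | zero => rfl
  | succ n ih =>
    rw [Finset.sum_range_succ, ih, omega_pow_eq_lucasU, Finset.sum_range_succ,
      Finset.sum_range_succ]
    have hre : ((b : QuadraticAlgebra ℤ (-5) 5) ^ d n).re = b ^ d n := by
      rw [← Nat.cast_pow, re_natCast, Nat.cast_pow]
    have him : ((b : QuadraticAlgebra ℤ (-5) 5) ^ d n).im = 0 := by
      rw [← Nat.cast_pow, im_natCast]
    ext <;> simp [hre, him] <;> ring

theorem natCast_dvd_quadraticAlgebra_iff {a b : ℤ} (n : ℕ) (z : QuadraticAlgebra ℤ a b) :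
    (n : QuadraticAlgebra ℤ a b) ∣ z ↔ (n : ℤ) ∣ z.re ∧ (n : ℤ) ∣ z.im := by
  rw [← algebraMap_dvd_iff, map_natCast]

theorem ratModEq_of_mul_eq {m : ℕ} {x y : ℚ} {D z : ℤ} (hD : IsCoprime (m : ℤ) D)
    (h : (x - y) * D = z) (hz : (m : ℤ) ∣ z) : RatModEq m x y := by
  refine hD.dvd_of_dvd_mul_right (?_ : (m : ℤ) ∣ (x - y).num * D)
  have hx : ((x - y).num : ℚ) = (x - y) * (x - y).den := (Rat.mul_den_eq_num _).symm
  have : (x - y).num * D = z * (x - y).den := by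
    have : ((x - y).num : ℚ) * D = z * (x - y).den := by rw [hx, ← h]; ring
    exact_mod_cast this
  rw [this]
  exact hz.mul_right _

theorem sum_div_pow_mul_pow (u : ℕ → ℤ) (c : ℕ → ℕ) {b : ℕ} (hb : b ≠ 0) (n : ℕ) :
    (∑ k ∈ Finset.range (n + 1), (u k : ℚ) / b ^ k * c k) * b ^ n
      = ((∑ k ∈ Finset.range (n + 1), u k * b ^ (n - k) * c k : ℤ) : ℚ) := by
  push_cast
  rw [Finset.sum_mul]
  refine Finset.sum_congr rfl fun k hk => ?_
  obtain ⟨i, rfl⟩ : ∃ i, n = k + i := ⟨n - k, by have := Finset.mem_range.1 hk; omega⟩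
  have : (b : ℚ) ≠ 0 := by exact_mod_cast hb
  rw [Nat.add_sub_cancel_left, pow_add]
  field_simp

theorem jacobiSym_five_eq (n : ℕ) :
    jacobiSym (n : ℤ) 5 = if n % 5 = 0 then 0 else if n % 5 = 1 ∨ n % 5 = 4 then 1 else -1 := by
  rw [jacobiSym.mod_left]
  have h : n % 5 < 5 := Nat.mod_lt _ (by norm_num)
  rw [show ((n : ℤ) % (5 : ℕ)) = ((n % 5 : ℕ) : ℤ) by push_cast; rfl]
  interval_cases n % 5 <;> norm_num

theorem neg_one_pow_div_five {p : ℕ} (R : Type*) [Ring R] :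
    (-1 : R) ^ (p / 5) = if p % 10 < 5 then 1 else -1 := by
  split_ifs with h
  · exact Even.neg_one_pow (Nat.even_iff.2 (by omega))
  · exact Odd.neg_one_pow (Nat.odd_iff.2 (by omega))

theorem sq_dvd_sum_lucasU_mul_five_pow {p : ℕ} (hp : p.Prime) (hp2 : p ≠ 2) (hp5 : p ≠ 5) :
    ((p ^ 2 : ℕ) : ℤ) ∣ ∑ k ∈ Finset.range p, lucasU 5 5 k * 5 ^ (p - 1 - k) * (2 * k).choose k
        - 5 ^ (p - 1) * ((-1) ^ (p / 5) * (jacobiSym p 5 - 1)) ∧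
    ((p ^ 2 : ℕ) : ℤ) ∣
      ∑ k ∈ Finset.range p, lucasU 5 5 (k + 1) * 5 ^ (p - 1 - k) * (2 * k).choose k
        - 5 ^ (p - 1) * ((-1) ^ (p / 5) * (2 * jacobiSym p 5 - 1)) := by
  obtain ⟨j, hj⟩ : ∃ j, p = 2 * j + 1 := hp.odd_of_ne_two hp2
  have h5 : p % 5 ≠ 0 := fun h =>
    hp5 ((Nat.prime_dvd_prime_iff_eq Nat.prime_five hp).1 (Nat.dvd_of_mod_eq_zero h)).symm
  set a : QuadraticAlgebra ℤ (-5) 5 := ⟨0, 1⟩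
  set m : QuadraticAlgebra ℤ (-5) 5 := ⟨5, -1⟩
  have ham : a * m = 5 := by ext <;> simp [a, m]
  have hm2 : m - 2 = ⟨3, -1⟩ := by ext <;> simp [m]
  have hw : (m - 2) ^ 2 = (m - 2) + 1 := by rw [hm2, sq]; ext <;> simp
  set J := jacobiSym p 5 with hJ
  set e : ℤ := (-1) ^ (p / 5) with he
  rw [neg_one_pow_div_five] at he
  rw [jacobiSym_five_eq] at hJ
  -- The constant c is X − 5Y + Yω, where Y and X are the values claimed for the u_k and u_{k+1}
  -- sums.
  obtain ⟨s, hc, hs⟩ : ∃ s : QuadraticAlgebra ℤ (-5) 5,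
      vietaU (m - 2) (j + 1) + vietaU (m - 2) j
        = ⟨e * (2 * J - 1) - 5 * (e * (J - 1)), e * (J - 1)⟩
          * (vietaU (m - 2) (j + 1) - vietaU (m - 2) j) ∧
      s * (vietaU (m - 2) (j + 1) + vietaU (m - 2) j) = 1 := by
    rw [vietaU_of_mod_ten _ hw j, vietaU_of_mod_ten _ hw (j + 1)]
    rw [show p % 10 = (2 * (j % 10) + 1) % 10 by omega] at he
    rw [show p % 5 = (2 * (j % 10) + 1) % 5 by omega] at hJ
    rw [show (j + 1) % 10 = (j % 10 + 1) % 10 by omega]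
    -- The residues 2 and 7 would make p divisible by 5.
    have hcases : j % 10 = 0 ∨ j % 10 = 1 ∨ j % 10 = 3 ∨ j % 10 = 4 ∨ j % 10 = 5 ∨ j % 10 = 6 ∨
        j % 10 = 8 ∨ j % 10 = 9 := by omega
    rw [hm2]
    rcases hcases with h | h | h | h | h | h | h | h <;>
      rw [h] at he hJ ⊢ <;> norm_num at he hJ <;> rw [he, hJ]
    · exact ⟨1, by ext <;> simp [vietaU], by ext <;> simp [vietaU]⟩
    · exact ⟨⟨-1, 1⟩, by ext <;> simp [vietaU], by ext <;> simp [vietaU]⟩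
    · exact ⟨⟨-1, 1⟩, by ext <;> simp [vietaU], by ext <;> simp [vietaU]⟩
    · exact ⟨1, by ext <;> simp [vietaU], by ext <;> simp [vietaU]⟩
    · exact ⟨-1, by ext <;> simp [vietaU], by ext <;> simp [vietaU]⟩
    · exact ⟨⟨1, -1⟩, by ext <;> simp [vietaU], by ext <;> simp [vietaU]⟩
    · exact ⟨⟨1, -1⟩, by ext <;> simp [vietaU], by ext <;> simp [vietaU]⟩
    · exact ⟨-1, by ext <;> simp [vietaU], by ext <;> simp [vietaU]⟩
  have key := sq_dvd_sum_centralBinom_mul_pow_mul_five_pow_sub ham hp hj hc hs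
  have hsum := sum_mul_omega_pow_mul_pow (fun k => (2 * k).choose k) (fun k => p - 1 - k) 5 p
  simp only [Nat.cast_ofNat] at hsum
  rw [hsum, natCast_dvd_quadraticAlgebra_iff] at key
  have h5p : (5 : QuadraticAlgebra ℤ (-5) 5) ^ (p - 1) = ((5 ^ (p - 1) : ℤ) : _) := by
    push_cast; rfl
  rw [h5p] at key
  simp only [re_sub, im_sub, re_mul, im_mul, re_intCast, im_intCast, Int.cast_id,
    sub_mul, Finset.sum_sub_distrib, mul_assoc, ← Finset.mul_sum] at key
  obtain ⟨⟨x, hx⟩, ⟨y, hy⟩⟩ := key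
  simp only [mul_assoc]
  exact ⟨⟨y, by linear_combination hy⟩, ⟨x + 5 * y, by linear_combination hx + 5 * hy⟩⟩

theorem sq_dvd_sum_lucas_mul_sixteen_pow {p j : ℕ} (hp : p.Prime) (hj : p = 2 * j + 1)
    (hp5 : p ≠ 5) :
    ((p ^ 2 : ℕ) : ℤ) ∣
      2 * ∑ k ∈ Finset.range (j + 1), lucasU 5 5 k * 16 ^ (j - k) * (2 * k).choose k
        - 16 ^ j * (jacobiSym p 5 - 1) ∧
    ((p ^ 2 : ℕ) : ℤ) ∣
      2 * ∑ k ∈ Finset.range (j + 1), lucasV 5 5 k * 16 ^ (j - k) * (2 * k).choose k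
        - 16 ^ j * (5 * jacobiSym p 5 - 1) := by
  have h5 : p % 5 ≠ 0 := fun h =>
    hp5 ((Nat.prime_dvd_prime_iff_eq Nat.prime_five hp).1 (Nat.dvd_of_mod_eq_zero h)).symm
  set a : QuadraticAlgebra ℤ (-5) 5 := ⟨0, 1⟩
  have ha2 : 2 - a = ⟨2, -1⟩ := by ext <;> simp [a]
  have hw : (2 - a) ^ 2 = 1 - (2 - a) := by rw [ha2, sq]; ext <;> simp
  set J := jacobiSym p 5 with hJ
  rw [jacobiSym_five_eq] at hJ
  obtain ⟨d, hd, hQ⟩ : ∃ d : ℤ, J - 1 = 2 * d ∧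
      vietaU (2 - a) (j + 1) - vietaU (2 - a) j = ⟨1, d⟩ := by
    rw [vietaU_of_mod_five _ hw j, vietaU_of_mod_five _ hw (j + 1)]
    rw [show p % 5 = (2 * (j % 5) + 1) % 5 by omega] at hJ
    rw [show (j + 1) % 5 = (j % 5 + 1) % 5 by omega, ha2]
    have hcases : j % 5 = 0 ∨ j % 5 = 1 ∨ j % 5 = 3 ∨ j % 5 = 4 := by omega
    rcases hcases with h | h | h | h <;> rw [h] at hJ ⊢ <;> norm_num at hJ <;> rw [hJ]
    · exact ⟨0, by norm_num, by ext <;> simp [vietaU]⟩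
    · exact ⟨-1, by norm_num, by ext <;> simp [vietaU]⟩
    · exact ⟨-1, by norm_num, by ext <;> simp [vietaU]⟩
    · exact ⟨0, by norm_num, by ext <;> simp [vietaU]⟩
  have key := sq_dvd_sum_centralBinom_mul_pow_mul_sixteen_pow_sub a hp hj
  have hsum := sum_mul_omega_pow_mul_pow (fun k => (2 * k).choose k) (fun k => j - k) 16 (j + 1)
  simp only [Nat.cast_ofNat] at hsum
  rw [hsum, natCast_dvd_quadraticAlgebra_iff, hQ,
    show (16 : QuadraticAlgebra ℤ (-5) 5) ^ j
      = ((16 ^ j : ℤ) : QuadraticAlgebra ℤ (-5) 5) by push_cast; rfl] at key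
  simp only [re_sub, im_sub, re_mul, im_mul, re_intCast, im_intCast, Int.cast_id,
    sub_mul, Finset.sum_sub_distrib, mul_assoc, ← Finset.mul_sum] at key
  obtain ⟨⟨x, hx⟩, ⟨y, hy⟩⟩ := key
  simp only [(lucasV_eq _).1, sub_mul, Finset.sum_sub_distrib, mul_assoc, ← Finset.mul_sum]
  -- As v_k = 2u_{k+1} − 5u_k, the v-sum is twice the constant coordinate plus five times the
  -- ω-coordinate; the statement doubles this again.
  exact ⟨⟨2 * y, by linear_combination 2 * hy - 16 ^ j * hd⟩,
    ⟨4 * x + 10 * y, by linear_combination 4 * hx + 10 * hy - 5 * 16 ^ j * hd⟩⟩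

end Quadratic

/-! ### Clearing denominators -/

theorem theorem1p2 (p : ℕ) (hp : p.Prime) (hp2 : p ≠ 2) (hp5 : p ≠ 5) :
    RatModEq (p ^ 2)
      (∑ k ∈ Finset.range p, (lucasU 5 5 k : ℚ) / 5 ^ k * (Nat.choose (2 * k) k : ℚ))
      ((-1) ^ (p / 5) * ((jacobiSym (p : ℤ) 5 : ℚ) - 1)) ∧
    RatModEq (p ^ 2)
      (∑ k ∈ Finset.range p, (lucasU 5 5 (k + 1) : ℚ) / 5 ^ k * (Nat.choose (2 * k) k : ℚ))
      ((-1) ^ (p / 5) * (2 * (jacobiSym (p : ℤ) 5 : ℚ) - 1)) ∧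
    RatModEq (p ^ 2)
      (∑ k ∈ Finset.range ((p - 1) / 2 + 1),
        (lucasU 5 5 k : ℚ) / 16 ^ k * (Nat.choose (2 * k) k : ℚ))
      (((jacobiSym (p : ℤ) 5 : ℚ) - 1) / 2) ∧
    RatModEq (p ^ 2)
      (∑ k ∈ Finset.range ((p - 1) / 2 + 1),
        (lucasV 5 5 k : ℚ) / 16 ^ k * (Nat.choose (2 * k) k : ℚ))
      ((5 * (jacobiSym (p : ℤ) 5 : ℚ) - 1) / 2) := by
  obtain ⟨j, hj⟩ : ∃ j, p = 2 * j + 1 := hp.odd_of_ne_two hp2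
  have hj' : (p - 1) / 2 = j := by omega
  have hpp : p - 1 + 1 = p := by omega
  have h1 := sq_dvd_sum_lucasU_mul_five_pow hp hp2 hp5
  have h2 := sq_dvd_sum_lucas_mul_sixteen_pow hp hj hp5
  have c5 : IsCoprime ((p ^ 2 : ℕ) : ℤ) (5 ^ (p - 1) : ℤ) := by
    have : Nat.Coprime (p ^ 2) (5 ^ (p - 1)) :=
      ((Nat.coprime_primes hp Nat.prime_five).2 hp5).pow _ _
    exact_mod_cast Nat.isCoprime_iff_coprime.2 this
  have c2 : Nat.Coprime p 2 := (Nat.coprime_primes hp Nat.prime_two).2 hp2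
  have c16 : IsCoprime ((p ^ 2 : ℕ) : ℤ) (2 * 16 ^ j : ℤ) := by
    have h16 : Nat.Coprime p 16 := by simpa using c2.pow_right 4
    have : Nat.Coprime (p ^ 2) (2 * 16 ^ j) :=
      (c2.mul_right (h16.pow_right _)).pow_left _
    exact_mod_cast Nat.isCoprime_iff_coprime.2 this
  have e1 (u : ℕ → ℤ) := sum_div_pow_mul_pow u (fun k => (2 * k).choose k)
    (b := 5) (by norm_num) (p - 1)
  have e2 (u : ℕ → ℤ) := sum_div_pow_mul_pow u (fun k => (2 * k).choose k)
    (b := 16) (by norm_num) j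
  simp only [hpp, Nat.cast_ofNat] at e1 e2
  rw [hj']
  refine ⟨ratModEq_of_mul_eq c5 ?_ h1.1, ratModEq_of_mul_eq c5 ?_ h1.2,
    ratModEq_of_mul_eq c16 ?_ h2.1, ratModEq_of_mul_eq c16 ?_ h2.2⟩
  · have := e1 (fun k => lucasU 5 5 k)
    rw [Int.cast_sub, ← this]
    push_cast
    ring
  · have := e1 (fun k => lucasU 5 5 (k + 1))
    rw [Int.cast_sub, ← this]
    push_cast
    ring
  · have := e2 (fun k => lucasU 5 5 k)
    push_cast at this ⊢
    linear_combination 2 * this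
  · have := e2 (fun k => lucasV 5 5 k)
    push_cast at this ⊢
    linear_combination 2 * this
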